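/- \textbf{Existence of CBCP equilibria.} Let $(V,E)$ be an acyclic directed network with finite edge set $E$, in which every edge has two lanes: a tollable express lane ($k=1$) and a toll-free general-purpose lane ($k=2$), with a common latency function $\ell_e$ that is increasing and convex on $[0,\infty)$. Users travel in periods $t\in[T]=\{1,\dots,T\}$ and form a finite set $G=G^E\sqcup G^I$ of eligible and ineligible groups. Each group $g\in G$ has an origin $p_o^g$, a destination $p_d^g$, a nonempty set $R(p^g)$ of directed routes from $p_o^g$ to $p_d^g$, a demand $d^g\ge 0$, and values of time $v_t^g\ge 0$, which may vary with $t$ (also for eligible groups). Let $G_e$ be the set of groups $g$ such that some route in $R(p^g)$ contains $e$. Write $E_i^{\mathrm{out}}$, $E_i^{\mathrm{in}}$ for the sets of edges leaving and entering a node $i$. A flow is a vector $\mathbf y=(y^g_{e,k,t})_{e\in E,\,k\in\{1,2\},\,t\in[T],\,g\in G_e}$ (with the convention $y^g_{e,k,t}=0$ for $g\notin G_e$), with lane flows $x_{e,k,t}=\sum_{g\in G_e}y^g_{e,k,t}$. Given tolls $\boldsymbol\tau=(\tau_{e,t})\in\mathbb R_{\ge0}^{|E|T}$ and budgets $\mathbf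 B=(B^g)\in\mathbb R_{\ge0}^{|G^E|}$, the feasible set $\mathcal Y(\boldsymbol\tau,\mathbf B)$ consists of the flows $\mathbf y\ge 0$ such that $$d^g\,\mathbf 1\{i=p_o^g\}+\sum_{e\in E_i^{\mathrm{in}}}\sum_{k=1}^2 y^g_{e,k,t}=d^g\,\mathbf 1\{i=p_d^g\}+\sum_{e\in E_i^{\mathrm{out}}}\sum_{k=1}^2 y^g_{e,k,t}\qquad\forall\, i\in V,\ g\in G,\ t\in[T],$$ $$\sum_{t\in[T]}\sum_{e\in E}y^g_{e,1,t}\,\tau_{e,t}\le B^g\qquad\forall\, g\in G^E.$$ The costs are $c^g_{e,k,t}(\mathbf y)=v_t^g\,\ell_e(x_{e,k,t})+\tau_{e,t}$ if $g\in G^I$ and $k=1$, and $c^g_{e,k,t}(\mathbf y)=v_t^g\,\ell_e(x_{e,k,t})$ otherwise. A $(\boldsymbol\tau,\mathbf B)$-CBCP equilibrium (Nash equilibrium flow of the credit-based congestion pricing game) is a flow $\mathbf y^\star\in\mathcal Y(\boldsymbol\tau,\mathbf B)$ such that, for every group $g\in G$, $$\sum_{e\in E}\sum_{k=1}^2\sum_{t=1}^T\bigl(y^g_{e,k,t}-y^{g\star}_{e,k,t}\bigr)\,c^g_{e,k,t}(\mathbf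 y^\star)\ge 0\qquad\forall\,\mathbf y\in\mathcal Y(\boldsymbol\tau,\mathbf B).$$ Then, for all $\boldsymbol\tau\in\mathbb R_{\ge0}^{|E|T}$ and $\mathbf B\in\mathbb R_{\ge0}^{|G^E|}$, a $(\boldsymbol\tau,\mathbf B)$-CBCP equilibrium exists. -/

import Mathlib

namespace CBCP

/-- With `tail e` and `head e` the start and end node of the edge `e`, the list of edges is a
directed route from the first node to the second one (the empty list is the route from a node
to itself). -/
def IsRoute {V E : Type*} (tail head : E → V) : V → V → List E → Prop
  | i, j, [] => i = j
  | i, j, e :: r => tail e = i ∧ IsRoute tail head (head e) j r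

/-- A traffic network: an acyclic directed multigraph with nodes `V` and edges `E`, a set of
origin-destination pairs (trips), a nonempty set of routes for each of them, and an increasing,
convex latency function of the (nonnegative) lane flow for each edge.  Every edge has two lanes,
which are indexed by `Fin 2`: lane `0` is the express lane and lane `1` the general-purpose lane;
the two lanes share the latency function of the edge. -/
structure TrafficNetwork (V E : Type*) where
  tail : E → V
  head : E → V
  acyclic : ∀ (i : V) (r : List E), IsRoute tail head i i r → r = []
  odPairs : Set (V × V)
  routes : V × V → Set (List E)
  routes_isRoute : ∀ p ∈ odPairs, ∀ r ∈ routes p, IsRoute tail head p.1 p.2 r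
  routes_nonempty : ∀ p ∈ odPairs, (routes p).Nonempty
  latency : E → ℝ → ℝ
  latency_monotone : ∀ e, MonotoneOn (latency e) (Set.Ici 0)
  latency_convex : ∀ e, ConvexOn ℝ (Set.Ici 0) (latency e)

/-- A population of user groups `G`, eligible or not, commuting over the network `N` in each of
`T` periods.  The value of time of a group may vary over the periods; its demand is fixed. -/
structure Population {V E : Type*} (N : TrafficNetwork V E) (G : Type*) (T : ℕ) where
  eligible : Set G
  od : G → V × V
  od_mem : ∀ g, od g ∈ N.odPairs
  vot : G → Fin T → ℝ
  vot_nonneg : ∀ g t, 0 ≤ vot g t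
  demand : G → ℝ
  demand_nonneg : ∀ g, 0 ≤ demand g

/-- `y e k t g` is the flow of group `g` on lane `k` of edge `e` in period `t`. -/
abbrev Flow (E G : Type*) (T : ℕ) : Type _ := E → Fin 2 → Fin T → G → ℝ

namespace Population

variable {V E G : Type*} [Fintype E] [Fintype G] {T : ℕ} {N : TrafficNetwork V E}

open Classical in
/-- The set `G_e` of the groups that have a route through the edge `e`. -/
noncomputable def groupsOn (P : Population N G T) (e : E) : Finset G :=
  Finset.univ.filter fun g => ∃ r ∈ N.routes (P.od g), e ∈ r

open Classical in
/-- Admissible flows: nonnegative flows that satisfy flow continuity at every node.  A flow only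
has coordinates `y e k t g` with `g ∈ G_e`; the others are set to zero here. -/
def admissible (P : Population N G T) : Set (Flow E G T) :=
  {y | (∀ e k t g, 0 ≤ y e k t g) ∧
    (∀ e k t g, g ∉ P.groupsOn e → y e k t g = 0) ∧
    ∀ (i : V) (g : G) (t : Fin T),
      (if i = (P.od g).1 then P.demand g else 0)
          + ∑ e ∈ Finset.univ.filter (fun e => N.head e = i), ∑ k : Fin 2, y e k t g
        = (if i = (P.od g).2 then P.demand g else 0)
          + ∑ e ∈ Finset.univ.filter (fun e => N.tail e = i), ∑ k : Fin 2, y e k t g}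

/-- The lane flow `x_{e,k,t}`. -/
noncomputable def laneFlow (P : Population N G T) (y : Flow E G T)
    (e : E) (k : Fin 2) (t : Fin T) : ℝ :=
  ∑ g ∈ P.groupsOn e, y e k t g

/-- The feasible flows of the CBCP game with tolls `τ` and budgets `B`. -/
def cbcpFeasible (P : Population N G T) (τ : E → Fin T → ℝ) (B : P.eligible → ℝ) :
    Set (Flow E G T) :=
  {y | y ∈ P.admissible ∧ ∀ g : P.eligible, ∑ t, ∑ e, y e 0 t g * τ e t ≤ B g}

open Classical in
/-- The cost to a user of group `g` of lane `k` of edge `e` in period `t`: only ineligible users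
pay the toll of the express lane out of pocket. -/
noncomputable def cbcpCost (P : Population N G T) (τ : E → Fin T → ℝ) (y : Flow E G T)
    (e : E) (k : Fin 2) (t : Fin T) (g : G) : ℝ :=
  if g ∉ P.eligible ∧ k = 0 then P.vot g t * N.latency e (P.laneFlow y e k t) + τ e t
  else P.vot g t * N.latency e (P.laneFlow y e k t)

/-- The CBCP equilibrium flows: the solutions of the group-wise variational inequality over the
feasible flows. -/
def cbcpEquilibria (P : Population N G T) (τ : E → Fin T → ℝ) (B : P.eligible → ℝ) :
    Set (Flow E G T) :=
  {yStar | yStar ∈ P.cbcpFeasible τ B ∧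
    ∀ g : G, ∀ y ∈ P.cbcpFeasible τ B,
      0 ≤ ∑ e, ∑ k : Fin 2, ∑ t,
        (y e k t g - yStar e k t g) * P.cbcpCost τ yStar e k t g}

end Population

end CBCP

/-!
An equilibrium is a solution of a variational inequality.  If the cost vector at `y` is paired with
flows through `totalCost τ y`, then any feasible `y` with `0 ≤ totalCost τ y (z - y)` for all
feasible `z` is an equilibrium: the constraints do not couple the groups, so one may test with a
`z` that differs from `y` in the coordinates of a single group only
(`update_group_mem_cbcpFeasible`).  As the values of time of a group vary over the periods, the
costs need not have a potential and need not be monotone, so that a topological existence theorem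
is needed: `exists_variational_inequality`, which asks for a nonempty compact convex set and a
continuous operator.

* The feasible set is nonempty, since every group can use the toll-free lanes of one route.  It is
  bounded because the network is acyclic: the flow of an edge is bounded by the demand and the flows
  of the preceding edges (`exists_flow_le`, by well-founded induction along
  `wellFounded_precedes`).
* The costs are continuous because an increasing convex function on `[0, ∞)` is continuous,
  including at `0`.

The existence theorem for variational inequalities follows by compactness from its version for the
convex hull of finitely many points, which is a complementarity problem on the standard simplex
(`exists_mem_stdSimplex_complementary`).  That problem is solved combinatorially.  The points of a
fine grid in the simplex are coloured by a coordinate in which the operator is smallest; a lemma of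
Scarf (`exists_dominant_image_eq_univ`) yields a set `C` of coordinates and grid points
of all colours in `C`, close to each other and to the face spanned by `C`, and a limit of such
points solves the problem.  Scarf's lemma itself is a parity argument: sets of `n` elements that
are dominant for `n` linear orders are counted together with their subsets of `n - 1` elements that
carry all colours but one.
-/

open Filter Topology

namespace Scarf

/-! ### Dominant sets for a finite family of linear orders -/

/-- A finite set `A` is dominant for the orders induced by `f i` if no element `y` lies, for all
`i` at once, strictly above the `f i`-minimum of `A`. -/
def Dominant {S I α : Type*} [LinearOrder α] (f : I → S → α) (A : Finset S) : Prop :=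
  ∀ y, ∃ i, ∀ x ∈ A, f i y ≤ f i x

lemma Dominant.mono {S I α : Type*} [LinearOrder α] {f : I → S → α} {A A' : Finset S}
    (h : Dominant f A) (hA : A' ⊆ A) : Dominant f A' :=
  fun y => (h y).imp fun _ hi x hx => hi x (hA hx)

/-- `IsTop f m a x` says that `x` is an `f a`-maximal element among the elements that lie strictly
above `m i` in the order `f i` for all `i ≠ a`. -/
def IsTop {S I α : Type*} [LinearOrder α] (f : I → S → α) (m : I → S) (a : I) (x : S) : Prop :=
  (∀ i, i ≠ a → f i (m i) < f i x) ∧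
    ∀ y, (∀ i, i ≠ a → f i (m i) < f i y) → f a y ≤ f a x

/-- If `n` orders have their minima on an `n - 1`-element dominant set `D` at `m`, then all of `D`
is attained and exactly one pair `a ≠ b` of indices shares its minimum. -/
lemma exists_collision {S I α : Type*} [DecidableEq S] [Fintype I] [DecidableEq I] [LinearOrder α]
    {f : I → S → α} (hf : ∀ i, Function.Injective (f i)) {D : Finset S}
    (hcard : D.card + 1 = Fintype.card I) (hD : Dominant f D) {m : I → S}
    (hmD : ∀ i, m i ∈ D) (hm : ∀ i, ∀ x ∈ D, f i (m i) ≤ f i x) :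
    (∀ x ∈ D, ∃ i, m i = x) ∧ ∃ a b, a ≠ b ∧ m a = m b ∧
      ∀ i j, i ≠ j → m i = m j → (i = a ∧ j = b) ∨ (i = b ∧ j = a) := by
  have hsurj : ∀ x ∈ D, ∃ i, m i = x := by
    intro x hx
    obtain ⟨i, hi⟩ := hD x
    exact ⟨i, hf i (le_antisymm (hm i x hx) (hi _ (hmD i)))⟩
  refine ⟨hsurj, ?_⟩
  obtain ⟨a, -, b, -, hab, hmab⟩ := Finset.exists_ne_map_eq_of_card_lt_of_maps_to
    (s := Finset.univ) (t := D) (f := m) (by rw [Finset.card_univ]; omega) (fun i _ => hmD i)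
  -- `m` is still onto `D` after removing `a` or `b`, hence injective there.
  have key : ∀ a b, a ≠ b → m a = m b → Set.InjOn m (Finset.univ.erase a : Finset I) := by
    intro a b hab hmab
    refine Finset.injOn_of_surjOn_of_card_le (t := D) m (fun i _ => hmD i) ?_ ?_
    · intro x hx
      obtain ⟨i, rfl⟩ := hsurj x hx
      by_cases hia : i = a
      · exact ⟨b, by simpa using hab.symm, by rw [hia, hmab]⟩
      · exact ⟨i, by simpa using hia, rfl⟩
    · rw [Finset.card_erase_of_mem (Finset.mem_univ a), Finset.card_univ]; omega
  refine ⟨a, b, hab, hmab, fun i j hij hmij => ?_⟩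
  have h1 : i = a ∨ j = a := by
    by_contra! h
    exact hij (key a b hab hmab (by simpa using h.1) (by simpa using h.2) hmij)
  have h2 : i = b ∨ j = b := by
    by_contra! h
    exact hij (key b a hab.symm hmab.symm (by simpa using h.1) (by simpa using h.2) hmij)
  grind

section Neighbours

variable {S I α : Type*} [DecidableEq S] [LinearOrder α] {f : I → S → α} {D : Finset S}
  {m : I → S} {a b : I}

lemma IsTop.dominant_insert (hD : Dominant f D) (hmD : ∀ i, m i ∈ D)
    (hm : ∀ i, ∀ x ∈ D, f i (m i) ≤ f i x) {x : S} (hx : IsTop f m a x) :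
    Dominant f (insert x D) := by
  intro y
  by_cases hy : ∀ i, i ≠ a → f i (m i) < f i y
  · refine ⟨a, fun z hz => ?_⟩
    obtain rfl | hz := Finset.mem_insert.1 hz
    · exact hx.2 y hy
    · obtain ⟨i, hi⟩ := hD y
      by_cases hia : i = a
      · exact hia ▸ hi z hz
      · exact absurd (hi _ (hmD i)) (not_le.2 (hy i hia))
  · push Not at hy
    obtain ⟨i, hia, hi⟩ := hy
    refine ⟨i, fun z hz => ?_⟩
    obtain rfl | hz := Finset.mem_insert.1 hz
    · exact hi.trans (hx.1 i hia).le
    · exact hi.trans (hm i z hz)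

/-- An element that can be added to `D` without destroying dominance becomes the new minimum for
exactly one of the two orders that shared a minimum on `D`. -/
lemma isTop_or_isTop_of_dominant_insert (hf : ∀ i, Function.Injective (f i))
    (hmD : ∀ i, m i ∈ D) (hm : ∀ i, ∀ x ∈ D, f i (m i) ≤ f i x)
    (huniq : ∀ i j, i ≠ j → m i = m j → (i = a ∧ j = b) ∨ (i = b ∧ j = a))
    {x : S} (hxD : x ∉ D) (hx : Dominant f (insert x D)) : IsTop f m a x ∨ IsTop f m b x := by
  have hcover : ∀ k, ∃ i, m i = m k ∧ f i (m i) < f i x := by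
    intro k
    obtain ⟨i, hi⟩ := hx (m k)
    have hik : m i = m k :=
      hf i (le_antisymm (hm i _ (hmD k)) (hi _ (Finset.mem_insert_of_mem (hmD i))))
    refine ⟨i, hik, lt_of_le_of_ne (hik ▸ hi x (Finset.mem_insert_self _ _)) fun h => hxD ?_⟩
    exact hf i h ▸ hmD i
  obtain ⟨k, hk⟩ := hx x
  have hkm : f k x ≤ f k (m k) := hk _ (Finset.mem_insert_of_mem (hmD k))
  have habove : ∀ i, i ≠ k → f i (m i) < f i x := by
    intro i hik
    obtain ⟨j, hj, hjx⟩ := hcover i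
    by_cases hji : j = i
    · exact hji ▸ hjx
    · obtain ⟨l, hl, hlx⟩ := hcover k
      have hlk : l ≠ k := by rintro rfl; exact absurd hkm (not_le.2 hlx)
      have hjk : j ≠ k := by rintro rfl; exact absurd hkm (not_le.2 hjx)
      have := huniq j i hji hj
      have := huniq l k hlk hl
      grind
  have htop : IsTop f m k x := by
    refine ⟨habove, fun y hy => ?_⟩
    obtain ⟨i, hi⟩ := hx y
    by_cases hik : i = k
    · exact hik ▸ hi x (Finset.mem_insert_self _ _)
    · exact absurd (hi _ (Finset.mem_insert_of_mem (hmD i))) (not_le.2 (hy i hik))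
  obtain ⟨l, hl, hlx⟩ := hcover k
  have hlk : l ≠ k := by rintro rfl; exact absurd hkm (not_le.2 hlx)
  rcases huniq l k hlk hl with ⟨-, rfl⟩ | ⟨-, rfl⟩
  · exact Or.inr htop
  · exact Or.inl htop

lemma IsTop.notMem {S I α : Type*} [LinearOrder α] {f : I → S → α} {D : Finset S} {m : I → S}
    {a b : I} (hsurj : ∀ x ∈ D, ∃ i, m i = x) (hab : a ≠ b) (hmab : m a = m b) {x : S}
    (hx : IsTop f m a x) : x ∉ D := by
  intro hxD
  obtain ⟨i, rfl⟩ := hsurj x hxD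
  by_cases hia : i = a
  · subst hia
    exact absurd (hx.1 b hab.symm) (by rw [hmab]; exact lt_irrefl _)
  · exact lt_irrefl _ (hx.1 i hia)

lemma exists_isTop {S I α : Type*} [Finite S] [LinearOrder α] {f : I → S → α} {m : I → S} {a : I}
    (h : ∃ y, ∀ i, i ≠ a → f i (m i) < f i y) : ∃ x, IsTop f m a x := by
  obtain ⟨x, hx, hmax⟩ := Set.exists_max_image {y | ∀ i, i ≠ a → f i (m i) < f i y} (f a)
    (Set.toFinite _) h
  exact ⟨x, hx, hmax⟩

/-- A dominant set with one element less than there are orders extends to exactly two dominant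
sets with one more element, as soon as the two orders that share a minimum leave room. -/
lemma card_dominant_extensions_eq_two [Fintype S] [Fintype I] [DecidableEq I]
    (hf : ∀ i, Function.Injective (f i)) (hcard : D.card + 1 = Fintype.card I)
    (hD : Dominant f D) (hmD : ∀ i, m i ∈ D) (hm : ∀ i, ∀ x ∈ D, f i (m i) ≤ f i x)
    (hroom : ∀ a, (∃ b, b ≠ a ∧ m a = m b) → ∃ y, ∀ i, i ≠ a → f i (m i) < f i y)
    (𝓡 : Finset (Finset S))
    (h𝓡 : ∀ R, R ∈ 𝓡 ↔ R.card = Fintype.card I ∧ Dominant f R) :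
    (𝓡.filter (fun R => D ⊆ R)).card = 2 := by
  obtain ⟨hsurj, a, b, hab, hmab, huniq⟩ := exists_collision hf hcard hD hmD hm
  obtain ⟨u, hu⟩ := exists_isTop (hroom a ⟨b, hab.symm, hmab⟩)
  obtain ⟨v, hv⟩ := exists_isTop (hroom b ⟨a, hab, hmab.symm⟩)
  have huD := hu.notMem hsurj hab hmab
  have hvD := hv.notMem hsurj hab.symm hmab.symm
  have huv : u ≠ v := by
    rintro rfl
    obtain ⟨i, hi⟩ := hD u
    by_cases hia : i = a
    · exact absurd (hi _ (hmD i)) (not_le.2 (hv.1 i (hia ▸ hab)))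
    · exact absurd (hi _ (hmD i)) (not_le.2 (hu.1 i hia))
  have heq : 𝓡.filter (fun R => D ⊆ R) = {insert u D, insert v D} := by
    ext R
    simp only [Finset.mem_filter, h𝓡, Finset.mem_insert, Finset.mem_singleton]
    constructor
    · rintro ⟨⟨hRc, hR⟩, hDR⟩
      obtain ⟨x, hxD, rfl⟩ := Finset.exists_eq_insert_iff.2 ⟨hDR, hcard.trans hRc.symm⟩
      rcases isTop_or_isTop_of_dominant_insert hf hmD hm huniq hxD hR with h | h
      · exact Or.inl (by rw [hf a (le_antisymm (hu.2 x h.1) (h.2 u hu.1))])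
      · exact Or.inr (by rw [hf b (le_antisymm (hv.2 x h.1) (h.2 v hv.1))])
    · rintro (rfl | rfl)
      · exact ⟨⟨by rw [Finset.card_insert_of_notMem huD, hcard], hu.dominant_insert hD hmD hm⟩,
          Finset.subset_insert _ _⟩
      · exact ⟨⟨by rw [Finset.card_insert_of_notMem hvD, hcard], hv.dominant_insert hD hmD hm⟩,
          Finset.subset_insert _ _⟩
  rw [heq, Finset.card_pair]
  intro h
  have : u ∈ insert v D := h ▸ Finset.mem_insert_self u D
  exact (Finset.mem_insert.1 this).elim huv huD

end Neighbours

/-! ### Colourings and the parity argument -/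

/-- In a set of `n` elements that misses one of the `n` colours, the number of
`n - 1`-element subsets carrying exactly the colours other than `i₀` is zero or two. -/
lemma even_card_doors {S I : Type*} [DecidableEq S] [Fintype I] [DecidableEq I]
    (c : S → I) (i₀ : I) {R : Finset S} (hR : R.card = Fintype.card I)
    (hRc : R.image c ≠ Finset.univ) (𝓓 : Finset (Finset S))
    (h𝓓 : ∀ D, D ⊆ R → (D ∈ 𝓓 ↔ D.card + 1 = Fintype.card I ∧
      D.image c = Finset.univ.erase i₀)) :
    Even (𝓓.filter (fun D => D ⊆ R)).card := by
  obtain hempty | ⟨D, hDmem⟩ := (𝓓.filter (fun D => D ⊆ R)).eq_empty_or_nonempty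
  · simp [hempty]
  obtain ⟨hD, hDR⟩ := Finset.mem_filter.1 hDmem
  obtain ⟨hDc, hDi⟩ := (h𝓓 D hDR).1 hD
  obtain ⟨x, hxD, hRx⟩ := Finset.exists_eq_insert_iff.2 ⟨hDR, hDc.trans hR.symm⟩
  replace hRx := hRx.symm
  have hcx : c x ∈ D.image c := by
    rw [hDi]
    refine Finset.mem_erase.2 ⟨fun h => hRc ?_, Finset.mem_univ _⟩
    rw [hRx, Finset.image_insert, hDi, h, Finset.insert_erase (Finset.mem_univ _)]
  obtain ⟨x', hx'D, hx'⟩ := Finset.mem_image.1 hcx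
  have hinj : Set.InjOn c D := by
    rw [← Finset.card_image_iff, hDi, Finset.card_erase_of_mem (Finset.mem_univ _),
      Finset.card_univ]
    omega
  have hxx' : x ≠ x' := fun h => hxD (h ▸ hx'D)
  have hx'R : x' ∈ R := hDR hx'D
  have hDx : D = R.erase x := by rw [hRx, Finset.erase_insert hxD]
  have heq : 𝓓.filter (fun D => D ⊆ R) = {R.erase x, R.erase x'} := by
    ext D'
    simp only [Finset.mem_filter, Finset.mem_insert, Finset.mem_singleton]
    constructor
    · rintro ⟨hD', hD'R⟩
      obtain ⟨hD'c, hD'i⟩ := (h𝓓 D' hD'R).1 hD'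
      obtain ⟨z, hz⟩ : ∃ z, R \ D' = {z} := by
        rw [← Finset.card_eq_one, Finset.card_sdiff_of_subset hD'R]; omega
      have hzm : z ∈ R \ D' := hz ▸ Finset.mem_singleton_self z
      have hD'z : D' = R.erase z := by
        rw [← Finset.sdiff_sdiff_eq_self hD'R, hz, Finset.sdiff_singleton_eq_erase]
      by_contra! hne
      have hzx : z ≠ x := by rintro rfl; exact hne.1 hD'z
      have hzx' : z ≠ x' := by rintro rfl; exact hne.2 hD'z
      have hzD : z ∈ D := by
        rw [hDx]; exact Finset.mem_erase.2 ⟨hzx, (Finset.mem_sdiff.1 hzm).1⟩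
      -- `D'` must contain an element with the colour of `z`.
      have hcz : c z ∈ D'.image c := by rw [hD'i, ← hDi]; exact Finset.mem_image_of_mem c hzD
      obtain ⟨w, hw, hwz⟩ := Finset.mem_image.1 hcz
      have hwz' : w ≠ z := by rintro rfl; exact (Finset.mem_sdiff.1 hzm).2 hw
      have hwR := hD'R hw
      rw [hRx] at hwR
      obtain rfl | hwD := Finset.mem_insert.1 hwR
      · exact hzx' (hinj hzD hx'D (by rw [hx', hwz]))
      · exact hwz' (hinj hwD hzD hwz)
    · rintro (rfl | rfl)
      · exact hDx ▸ ⟨hD, hDR⟩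
      · have hsub := Finset.erase_subset x' R
        refine ⟨(h𝓓 _ hsub).2 ⟨?_, ?_⟩, hsub⟩
        · rw [Finset.card_erase_of_mem hx'R, hR]
          have : 0 < R.card := Finset.card_pos.2 ⟨_, hx'R⟩
          omega
        · rw [← hDi]
          ext i
          simp only [Finset.mem_image, Finset.mem_erase, hRx, Finset.mem_insert]
          constructor
          · rintro ⟨w, ⟨hw, rfl | hwD⟩, rfl⟩
            · exact ⟨x', hx'D, hx'⟩
            · exact ⟨w, hwD, rfl⟩
          · rintro ⟨w, hwD, rfl⟩
            by_cases hwx : w = x'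
            · exact ⟨x, ⟨hxx', Or.inl rfl⟩, by rw [hwx, hx']⟩
            · exact ⟨w, ⟨hwx, Or.inr hwD⟩, rfl⟩
  rw [heq, Finset.card_pair]
  · exact even_two
  · intro h
    have h1 : x' ∈ R.erase x := Finset.mem_erase.2 ⟨hxx'.symm, hx'R⟩
    rw [h] at h1
    exact (Finset.mem_erase.1 h1).1 rfl

section Slack

variable {S I α : Type*} [Fintype S] [DecidableEq S] [Fintype I] [DecidableEq I] [LinearOrder α]

/-- The set of all slack elements but one is dominant and extends to exactly one dominant set with
one more element: the added element is the largest remaining one for the omitted order. -/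
lemma slack_door {f : I → S → α} (hf : ∀ i, Function.Injective (f i)) {s : I → S}
    (hs : Function.Injective s) (hmin : ∀ i x, f i (s i) ≤ f i x)
    (hmax : ∀ i j, i ≠ j → ∀ x, x ∉ Set.range s → f i x < f i (s j)) (i₀ : I)
    (𝓡 : Finset (Finset S))
    (h𝓡 : ∀ R, R ∈ 𝓡 ↔ R.card = Fintype.card I ∧ Dominant f R) :
    Dominant f ((Finset.univ.erase i₀).image s) ∧
      (𝓡.filter (fun R => (Finset.univ.erase i₀).image s ⊆ R)).card = 1 := by
  set D := (Finset.univ.erase i₀).image s with hDdef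
  have hmemD : ∀ x, x ∈ D ↔ ∃ j, j ≠ i₀ ∧ s j = x := by intro x; simp [hDdef]
  have hDc : D.card + 1 = Fintype.card I := by
    rw [hDdef, Finset.card_image_of_injective _ hs, Finset.card_erase_of_mem (Finset.mem_univ _),
      Finset.card_univ]
    have : 0 < Fintype.card I := Fintype.card_pos_iff.2 ⟨i₀⟩
    omega
  obtain ⟨u, hu, humax⟩ := Set.exists_max_image {y | y ∉ D} (f i₀) (Set.toFinite _)
    ⟨s i₀, fun h => by
      obtain ⟨j, hj, hj'⟩ := (hmemD _).1 h
      exact hj (hs hj')⟩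
  have hins : Dominant f (insert u D) := by
    intro y
    by_cases hy : y ∈ D
    · obtain ⟨j, -, rfl⟩ := (hmemD _).1 hy
      exact ⟨j, fun x _ => hmin j x⟩
    · refine ⟨i₀, fun x hx => ?_⟩
      obtain rfl | hx := Finset.mem_insert.1 hx
      · exact humax y hy
      · obtain ⟨j, hj, rfl⟩ := (hmemD _).1 hx
        by_cases hyr : y ∈ Set.range s
        · obtain ⟨k, rfl⟩ := hyr
          have : k = i₀ := by
            by_contra hk
            exact hy ((hmemD _).2 ⟨k, hk, rfl⟩)
          exact this ▸ hmin k _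
        · exact (hmax i₀ j hj.symm y hyr).le
  refine ⟨hins.mono (Finset.subset_insert _ _), ?_⟩
  rw [Finset.card_eq_one]
  refine ⟨insert u D, ?_⟩
  ext R
  simp only [Finset.mem_filter, h𝓡, Finset.mem_singleton]
  constructor
  · rintro ⟨⟨hRc, hR⟩, hDR⟩
    obtain ⟨x, hxD, hRx⟩ := Finset.exists_eq_insert_iff.2 ⟨hDR, hDc.trans hRc.symm⟩
    replace hRx := hRx.symm
    obtain ⟨i, hi⟩ := hR u
    have hii : i = i₀ := by
      by_contra hne
      have hsi : s i ∈ D := (hmemD _).2 ⟨i, hne, rfl⟩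
      have : u = s i := hf i (le_antisymm (hi _ (hDR hsi)) (hmin i u))
      exact hu (this ▸ hsi)
    subst hii
    have hux : u = x :=
      hf i (le_antisymm (hi x (hRx ▸ Finset.mem_insert_self x D)) (humax x hxD))
    rw [hRx, hux]
  · rintro rfl
    exact ⟨⟨by rw [Finset.card_insert_of_notMem hu, hDc], hins⟩, Finset.subset_insert _ _⟩

/-- **Scarf's lemma**, in a coloured version.  Let `n` linear orders on a finite set have slack
elements `s i`, where `s i` is the least element of the `i`-th order and lies above all
non-slack elements in the others.  For every colouring that gives `s i` the colour `i` some
dominant set of `n` elements carries all colours. -/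
theorem exists_dominant_image_eq_univ [Nonempty I] {f : I → S → α}
    (hf : ∀ i, Function.Injective (f i)) {s : I → S} (hmin : ∀ i x, f i (s i) ≤ f i x)
    (hmax : ∀ i j, i ≠ j → ∀ x, x ∉ Set.range s → f i x < f i (s j))
    {c : S → I} (hc : ∀ i, c (s i) = i) :
    ∃ R : Finset S, Dominant f R ∧ R.card = Fintype.card I ∧ R.image c = Finset.univ := by
  classical
  by_contra! hno
  have i₀ : I := Classical.arbitrary I
  have hs : Function.Injective s := fun i j h => by rw [← hc i, h, hc]
  let 𝓡 : Finset (Finset S) :=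
    Finset.univ.filter fun R => R.card = Fintype.card I ∧ Dominant f R
  let 𝓓 : Finset (Finset S) := Finset.univ.filter fun D =>
    D.card + 1 = Fintype.card I ∧ Dominant f D ∧ D.image c = Finset.univ.erase i₀
  have h𝓡 : ∀ R, R ∈ 𝓡 ↔ R.card = Fintype.card I ∧ Dominant f R := by simp [𝓡]
  let D₀ : Finset S := (Finset.univ.erase i₀).image s
  obtain ⟨hD₀, hD₀one⟩ := slack_door hf hs hmin hmax i₀ 𝓡 h𝓡
  have hD₀mem : D₀ ∈ 𝓓 := by
    refine Finset.mem_filter.2 ⟨Finset.mem_univ _, ?_, hD₀, ?_⟩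
    · rw [Finset.card_image_of_injective _ hs, Finset.card_erase_of_mem (Finset.mem_univ _),
        Finset.card_univ]
      have : 0 < Fintype.card I := Fintype.card_pos
      omega
    · rw [Finset.image_image]
      have : c ∘ s = id := funext hc
      rw [this, Finset.image_id]
  have hcount := Finset.sum_card_bipartiteAbove_eq_sum_card_bipartiteBelow
    (s := 𝓓) (t := 𝓡) (fun D R => D ⊆ R)
  have heven : Even (∑ R ∈ 𝓡, (𝓓.bipartiteBelow (fun D R => D ⊆ R) R).card) := by
    refine Finset.even_sum _ fun R hR => ?_
    obtain ⟨hRc, hRd⟩ := (h𝓡 R).1 hR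
    refine even_card_doors c i₀ hRc (hno R hRd hRc) 𝓓 fun D hDR => ?_
    simp only [𝓓, Finset.mem_filter, Finset.mem_univ, true_and]
    exact ⟨fun h => ⟨h.1, h.2.2⟩, fun h => ⟨h.1, hRd.mono hDR, h.2⟩⟩
  have htwo : ∀ D ∈ 𝓓.erase D₀, (𝓡.bipartiteAbove (fun D R => D ⊆ R) D).card = 2 := by
    intro D hD
    obtain ⟨hne, hD⟩ := Finset.mem_erase.1 hD
    obtain ⟨-, hDc, hDd, hDi⟩ := Finset.mem_filter.1 hD
    -- A set in `𝓓` that consists of slack elements only is `D₀`.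
    have hns : ∃ z ∈ D, z ∉ Set.range s := by
      by_contra! hall
      refine hne (Finset.Subset.antisymm (fun z hz => ?_) fun z hz => ?_)
      · obtain ⟨j, rfl⟩ := hall z hz
        have : c (s j) ∈ Finset.univ.erase i₀ := hDi ▸ Finset.mem_image_of_mem c hz
        exact Finset.mem_image_of_mem s (hc j ▸ this)
      · obtain ⟨j, hj, rfl⟩ := Finset.mem_image.1 hz
        rw [← hDi] at hj
        obtain ⟨w, hw, hwj⟩ := Finset.mem_image.1 hj
        obtain ⟨k, rfl⟩ := hall w hw
        rw [hc] at hwj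
        exact hwj ▸ hw
    obtain ⟨z, hzD, hz⟩ := hns
    choose m hmD hm using fun i => Finset.exists_min_image D (f i) ⟨z, hzD⟩
    refine card_dominant_extensions_eq_two hf hDc hDd hmD hm ?_ 𝓡 h𝓡
    -- The slack element of an order that shares its minimum leaves room.
    rintro a ⟨b, hba, hmab⟩
    have hslack : ∀ i k, m i = s k → k = i := by
      intro i k hik
      by_contra hki
      exact absurd (hm i z hzD) (not_le.2 (hik ▸ hmax i k (Ne.symm hki) z hz))
    refine ⟨s a, fun i hia => ?_⟩
    by_cases hr : m i ∈ Set.range s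
    · obtain ⟨k, hk⟩ := hr
      obtain rfl := hslack i k hk.symm
      rw [← hk]
      exact lt_of_le_of_ne (hmin _ _) fun h => hia (hs (hf _ h))
    · exact hmax i a hia _ hr
  rw [← Finset.add_sum_erase 𝓓 _ hD₀mem, Finset.sum_congr rfl htwo] at hcount
  rw [← hcount, Finset.sum_const, smul_eq_mul] at heven
  have hone : (𝓡.bipartiteAbove (fun D R => D ⊆ R) D₀).card = 1 := hD₀one
  rw [hone] at heven
  obtain ⟨k, hk⟩ := heven
  omega

end Slack

end Scarf

/-! ### Complementarity problems on the standard simplex -/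

namespace Scarf

/-- Scarf's lemma on the grid of the vectors `a : I → ℕ` with sum `N`: for every colouring of the
grid by `I` there is a nonempty set `C` of colours, and a grid point `q i` of each colour
`i ∈ C`, such that these points are close to each other and to the face spanned by `C`. -/
lemma exists_grid_points {I : Type*} [Fintype I] [DecidableEq I] [Nonempty I] (N : ℕ)
    (c : (I → ℕ) → I) :
    ∃ (C : Finset I) (q : I → I → ℕ), C.Nonempty ∧ (∀ i ∈ C, ∑ j, q i j = N ∧ c (q i) = i) ∧
      (∀ i ∈ C, ∀ k ∈ C, ∀ j, q i j ≤ q k j + Fintype.card I) ∧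
      ∀ i ∈ C, ∀ j, j ∉ C → q i j ≤ Fintype.card I := by
  classical
  let S := {a // a ∈ Finset.piAntidiag (Finset.univ : Finset I) N} ⊕ I
  let v : I → S → ℤ := fun i => Sum.elim (fun a => (a.1 i : ℤ)) fun j => if i = j then -1 else N + 1
  -- The second component breaks ties between grid points with the same `i`-th coordinate.
  let f : I → S → ℤ ×ₗ ℕ := fun i x => toLex (v i x, (Fintype.equivFin S x : ℕ))
  have hvle : ∀ i x y, f i x ≤ f i y → v i x ≤ v i y := by
    intro i x y h
    rcases Prod.Lex.toLex_le_toLex.1 h with h | h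
    · exact h.le
    · exact h.1.le
  have hvlt : ∀ i x y, v i x < v i y → f i x < f i y := fun i x y h =>
    Prod.Lex.toLex_lt_toLex.2 (Or.inl h)
  have hf : ∀ i, Function.Injective (f i) := by
    intro i x y h
    have := (Prod.ext_iff.1 (toLex.injective h)).2
    exact (Fintype.equivFin S).injective (Fin.ext this)
  have hsum : ∀ a : {a // a ∈ Finset.piAntidiag (Finset.univ : Finset I) N}, ∑ j, a.1 j = N :=
    fun a => (Finset.mem_piAntidiag.1 a.2).1
  obtain ⟨R, hR, -, hRc⟩ := exists_dominant_image_eq_univ (f := f) hf (s := Sum.inr)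
    (c := Sum.elim (fun a => c a.1) id)
    (by
      rintro i (a | j)
      · refine (hvlt _ _ _ ?_).le
        simp only [v, Sum.elim_inl, Sum.elim_inr, if_true]
        omega
      · by_cases hij : i = j
        · rw [hij]
        · refine (hvlt _ _ _ ?_).le
          simp only [v, Sum.elim_inr, if_true, if_neg hij]
          omega)
    (by
      rintro i j hij (a | k) hx
      · refine hvlt _ _ _ ?_
        have : a.1 i ≤ N := (Finset.single_le_sum (f := a.1) (fun _ _ => Nat.zero_le _)
          (Finset.mem_univ i)).trans (hsum a).le
        simp only [v, Sum.elim_inl, Sum.elim_inr, if_neg hij]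
        omega
      · exact absurd ⟨k, rfl⟩ hx)
    (fun i => rfl)
  let C : Finset I := Finset.univ.filter fun i => (Sum.inr i : S) ∉ R
  have hC : ∀ i, i ∈ C ↔ (Sum.inr i : S) ∉ R := by simp [C]
  have hpt : ∀ i, ∃ a : I → ℕ, i ∈ C → ∃ h, (Sum.inl ⟨a, h⟩ : S) ∈ R ∧ c a = i := by
    intro i
    by_cases hi : i ∈ C
    · obtain ⟨x, hxR, hxi⟩ := Finset.mem_image.1 (hRc ▸ Finset.mem_univ i)
      rcases x with a | j
      · exact ⟨a.1, fun _ => ⟨a.2, hxR, hxi⟩⟩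
      · exact absurd hxR ((hC j).1 ((show j = i from hxi) ▸ hi))
    · exact ⟨0, fun h => absurd h hi⟩
  choose q hq using hpt
  have hqsum : ∀ i ∈ C, ∑ j, q i j = N := fun i hi => hsum ⟨q i, (hq i hi).1⟩
  have hdom : ∀ y : I → ℕ, ∑ j, y j = N → ∃ i ∈ C, ∀ k ∈ C, y i ≤ q k i := by
    intro y hy
    obtain ⟨i, hi⟩ := hR (Sum.inl ⟨y, Finset.mem_piAntidiag.2 ⟨hy, fun _ _ => Finset.mem_univ _⟩⟩)
    refine ⟨i, (hC i).2 fun h => ?_, fun k hk => ?_⟩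
    · have := hvle _ _ _ (hi _ h)
      simp only [v, Sum.elim_inl, Sum.elim_inr, if_true] at this
      omega
    · have := hvle _ _ _ (hi _ (hq k hk).2.1)
      simpa [v] using this
  have hCne : C.Nonempty := by
    obtain ⟨i, hi, -⟩ := hdom (Pi.single (Classical.arbitrary I) N) (by simp)
    exact ⟨i, hi⟩
  choose w hwC hw using fun j => Finset.exists_min_image C (fun k => q k j) hCne
  set m : I → ℕ := fun j => q (w j) j
  have hCcard : C.card ≤ Fintype.card I := Finset.card_le_univ C
  -- Otherwise some grid point would exceed all minima, against dominance.
  have hbig : N < ∑ j ∈ C, m j + C.card := by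
    by_contra! hle
    obtain ⟨j₀, hj₀⟩ := hCne
    obtain ⟨i, hi, hiq⟩ := hdom (fun j => if j ∈ C then
      m j + 1 + (if j = j₀ then N - (∑ j ∈ C, m j + C.card) else 0) else 0) (by
        rw [Finset.sum_ite_mem, Finset.univ_inter, Finset.sum_add_distrib,
          Finset.sum_add_distrib, Finset.sum_ite_eq' C j₀, if_pos hj₀]
        simp only [Finset.sum_const, smul_eq_mul, mul_one]
        omega)
    have := hiq (w i) (hwC i)
    simp only [if_pos hi] at this
    have : m i + 1 ≤ m i := le_trans (by omega) this
    omega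
  have hsplit : ∀ k ∈ C, ∑ j ∈ C, q k j + ∑ j ∈ Cᶜ, q k j = N := fun k hk => by
    rw [Finset.sum_add_sum_compl, hqsum k hk]
  have hoff : ∀ k ∈ C, ∀ j, j ∉ C → q k j ≤ Fintype.card I := by
    intro k hk j hj
    have h1 : q k j ≤ ∑ j ∈ Cᶜ, q k j :=
      Finset.single_le_sum (f := q k) (fun _ _ => Nat.zero_le _) (Finset.mem_compl.2 hj)
    have h2 : ∑ j ∈ C, m j ≤ ∑ j ∈ C, q k j := Finset.sum_le_sum fun j _ => hw j k hk
    have := hsplit k hk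
    omega
  refine ⟨C, q, hCne, fun i hi => ⟨hqsum i hi, (hq i hi).2.2⟩, fun i hi k hk j => ?_, hoff⟩
  by_cases hj : j ∈ C
  · have h1 := Finset.add_sum_erase C (q i) hj
    have h2 := Finset.add_sum_erase C m hj
    have h3 : ∑ j ∈ C.erase j, m j ≤ ∑ j ∈ C.erase j, q i j :=
      Finset.sum_le_sum fun j _ => hw j i hi
    have h4 : m j ≤ q k j := hw j k hk
    have := hsplit i hi
    omega
  · exact (hoff i hi j hj).trans (Nat.le_add_left _ _)

/-- A continuous map `F` on the standard simplex has a point at which only coordinates with the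
smallest value of `F` carry weight. -/
theorem exists_mem_stdSimplex_complementary {I : Type*} [Fintype I] [Nonempty I]
    {F : (I → ℝ) → I → ℝ} (hF : ContinuousOn F (stdSimplex ℝ I)) :
    ∃ p ∈ stdSimplex ℝ I, ∀ i, 0 < p i → ∀ j, F p i ≤ F p j := by
  classical
  let n := Fintype.card I
  let scale : ℕ → (I → ℕ) → I → ℝ := fun N a j => (a j : ℝ) / (N + 1 : ℕ)
  have hscale : ∀ N a, ∑ j, a j = N + 1 → scale N a ∈ stdSimplex ℝ I := by
    intro N a ha
    refine ⟨fun j => by positivity, ?_⟩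
    simp only [scale]
    rw [← Finset.sum_div, ← Nat.cast_sum, ha, div_self (by positivity)]
  -- A grid point is coloured by a coordinate at which `F` is smallest.
  choose color hcolor using fun (x : I → ℝ) => Finite.exists_min (F x)
  have happrox : ∀ N : ℕ, ∃ (p : I → ℝ) (r : I → I → ℝ), p ∈ stdSimplex ℝ I ∧
      (∀ i, r i ∈ stdSimplex ℝ I) ∧ (∀ i j, |r i j - p j| ≤ n / (N + 1 : ℕ)) ∧
      ∀ i, p i ≤ n / (N + 1 : ℕ) ∨ ∀ j, F (r i) i ≤ F (r i) j := by
    intro N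
    obtain ⟨C, q, ⟨k, hk⟩, hq, hclose, hoff⟩ :=
      exists_grid_points (N + 1) fun a => color (scale N a)
    have hpos : (0 : ℝ) < (N + 1 : ℕ) := by positivity
    refine ⟨scale N (q k), fun i => if i ∈ C then scale N (q i) else scale N (q k),
      hscale _ _ (hq k hk).1, fun i => ?_, fun i j => ?_, fun i => ?_⟩
    · dsimp only
      split_ifs with hi
      · exact hscale _ _ (hq i hi).1
      · exact hscale _ _ (hq k hk).1
    · dsimp only
      split_ifs with hi
      · simp only [scale]
        rw [← sub_div, abs_div, abs_of_pos hpos]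
        gcongr
        have h1 : (q i j : ℝ) ≤ q k j + n := by exact_mod_cast hclose i hi k hk j
        have h2 : (q k j : ℝ) ≤ q i j + n := by exact_mod_cast hclose k hk i hi j
        exact abs_le.2 ⟨by linarith, by linarith⟩
      · rw [sub_self, abs_zero]; positivity
    · by_cases hi : i ∈ C
      · right
        simp only [if_pos hi]
        have := hcolor (scale N (q i))
        rwa [(hq i hi).2] at this
      · left
        simp only [scale]
        gcongr
        exact_mod_cast hoff k hk i hi
  choose p r hp hr hrp hpr using happrox
  obtain ⟨x, hx, φ, hφ, hlim⟩ := (isCompact_stdSimplex ℝ I).tendsto_subseq hp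
  have hε : Tendsto (fun N : ℕ => (n : ℝ) / (N + 1 : ℕ)) atTop (𝓝 0) :=
    (tendsto_const_div_atTop_nhds_zero_nat (n : ℝ)).comp (tendsto_add_atTop_nat 1)
  have hεφ := hε.comp hφ.tendsto_atTop
  refine ⟨x, hx, fun i hi j => ?_⟩
  have hlimr : Tendsto (fun N => r (φ N) i) atTop (𝓝 x) := by
    rw [tendsto_pi_nhds]
    intro j
    have h1 : Tendsto (fun N => r (φ N) i j - p (φ N) j) atTop (𝓝 0) :=
      squeeze_zero_norm (fun N => hrp (φ N) i j) hεφ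
    simpa using h1.add (tendsto_pi_nhds.1 hlim j)
  have hFr : Tendsto (fun N => F (r (φ N) i)) atTop (𝓝 (F x)) :=
    (hF x hx).tendsto.comp
      (tendsto_nhdsWithin_iff.2 ⟨hlimr, Eventually.of_forall fun N => hr _ i⟩)
  refine le_of_tendsto_of_tendsto (tendsto_pi_nhds.1 hFr i) (tendsto_pi_nhds.1 hFr j) ?_
  filter_upwards [hεφ.eventually_lt (tendsto_pi_nhds.1 hlim i) hi] with N hN
  exact (hpr (φ N) i).resolve_left (not_le.2 hN) j

end Scarf

/-! ### Variational inequalities on compact convex sets -/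

/-- **Hartman–Stampacchia theorem**: a variational inequality with continuous operator has a
solution on every nonempty compact convex set. -/
theorem exists_variational_inequality {X : Type*} [AddCommGroup X] [Module ℝ X]
    [TopologicalSpace X] [IsTopologicalAddGroup X] [ContinuousSMul ℝ X] [T2Space X] {K : Set X}
    (hK : IsCompact K) (hKc : Convex ℝ K) (hKne : K.Nonempty) (Φ : X → X →ₗ[ℝ] ℝ)
    (hΦ : ∀ y ∈ K, ContinuousOn (fun x => Φ x (y - x)) K) :
    ∃ x ∈ K, ∀ y ∈ K, 0 ≤ Φ x (y - x) := by
  classical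
  have hfinite : ∀ u : Finset K, ∃ x ∈ K, ∀ y ∈ u, 0 ≤ Φ x (y - x) := by
    intro u
    obtain rfl | hu := u.eq_empty_or_nonempty
    · obtain ⟨x, hx⟩ := hKne
      exact ⟨x, hx, by simp⟩
    have : Nonempty u := hu.to_subtype
    let comb : (u → ℝ) → X := fun p => ∑ i : u, p i • (i.1 : X)
    have hcomb : Continuous comb := by fun_prop
    have hmaps : Set.MapsTo comb (stdSimplex ℝ u) K := fun p hp =>
      hKc.sum_mem (fun i _ => hp.1 i) hp.2 fun i _ => i.1.2
    obtain ⟨p, hp, hpmin⟩ := Scarf.exists_mem_stdSimplex_complementary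
      (F := fun p i => Φ (comb p) ((i.1 : X) - comb p))
      (continuousOn_pi.2 fun i => (hΦ _ i.1.2).comp hcomb.continuousOn hmaps)
    refine ⟨comb p, hmaps hp, fun y hy => ?_⟩
    -- The weighted mean of the values at the points of `u` is `Φ (comb p) 0`.
    have hmean : ∑ i, p i * Φ (comb p) ((i.1 : X) - comb p) = 0 := by
      have h : ∑ i, p i • ((i.1 : X) - comb p) = 0 := by
        simp only [smul_sub, Finset.sum_sub_distrib]
        rw [← Finset.sum_smul, hp.2, one_smul, sub_self]
      have := congrArg (Φ (comb p)) h
      simpa using this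
    have hle : ∑ i, p i * Φ (comb p) ((i.1 : X) - comb p) ≤
        ∑ i, p i * Φ (comb p) ((y : X) - comb p) := by
      refine Finset.sum_le_sum fun i _ => ?_
      obtain h | h := (hp.1 i).eq_or_lt
      · rw [← h, zero_mul, zero_mul]
      · exact mul_le_mul_of_nonneg_left (hpmin i h ⟨y, hy⟩) h.le
    rwa [hmean, ← Finset.sum_mul, hp.2, one_mul] at hle
  have hclosed : ∀ y : K, IsClosed {x | x ∈ K ∧ 0 ≤ Φ x (y - x)} := fun y =>
    (hΦ y y.2).preimage_isClosed_of_isClosed hK.isClosed isClosed_Ici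
  obtain ⟨x, hx, hxall⟩ := hK.inter_iInter_nonempty _ hclosed fun u => by
    obtain ⟨x, hx, hxu⟩ := hfinite u
    exact ⟨x, hx, Set.mem_iInter₂.2 fun y hy => ⟨hx, hxu y hy⟩⟩
  exact ⟨x, hx, fun y hy => (Set.mem_iInter.1 hxall ⟨y, hy⟩).2⟩

/-! ### The latency functions -/

/-- An increasing convex function on `[0, ∞)` is continuous; monotonicity excludes a jump at the
end point `0`, which convexity alone allows. -/
lemma ConvexOn.continuousOn_Ici_of_monotoneOn {f : ℝ → ℝ} (hf : ConvexOn ℝ (Set.Ici 0) f)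
    (hmono : MonotoneOn f (Set.Ici 0)) : ContinuousOn f (Set.Ici 0) := by
  intro x hx
  obtain rfl | hx := (show (0 : ℝ) ≤ x from hx).eq_or_lt
  · have hbound : Tendsto (fun x : ℝ => (1 - x) * f 0 + x * f 1) (𝓝[Set.Ici 0] 0) (𝓝 (f 0)) := by
      have : Continuous fun x : ℝ => (1 - x) * f 0 + x * f 1 := by fun_prop
      have h := (this.tendsto 0).mono_left (nhdsWithin_le_nhds (s := Set.Ici 0))
      simpa using h
    refine tendsto_of_tendsto_of_tendsto_of_le_of_le' tendsto_const_nhds hbound ?_ ?_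
    · filter_upwards [self_mem_nhdsWithin] with x hx
      exact hmono Set.self_mem_Ici hx hx
    · filter_upwards [self_mem_nhdsWithin, nhdsWithin_le_nhds (Iio_mem_nhds zero_lt_one)]
        with x hx hx1
      have hx : (0 : ℝ) ≤ x := hx
      have hx1 : x < 1 := hx1
      have := hf.2 (Set.self_mem_Ici (a := (0 : ℝ))) (Set.mem_Ici.2 zero_le_one)
        (sub_nonneg.2 hx1.le) hx (sub_add_cancel 1 x)
      simpa using this
  · have h := (hf.subset Set.Ioi_subset_Ici_self (convex_Ioi 0)).continuousOn isOpen_Ioi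
    exact (h.continuousAt (Ioi_mem_nhds hx)).continuousWithinAt

namespace CBCP

/-! ### Routes -/

/-- A route enters each node as often as it leaves it, up to its first and last node. -/
lemma IsRoute.count_balance {V E : Type*} [Fintype E] [DecidableEq V] [DecidableEq E]
    {tail head : E → V} (v : V) : ∀ {r : List E} {i j : V}, IsRoute tail head i j r →
      (if v = i then 1 else 0) + ∑ e with head e = v, r.count e =
        (if v = j then 1 else 0) + ∑ e with tail e = v, r.count e
  | [], i, j, h => by
    obtain rfl : i = j := h
    simp
  | e₀ :: r, i, j, h => by
    obtain ⟨rfl, h⟩ := h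
    have ih := IsRoute.count_balance v h
    have hsum : ∀ p : E → V, ∑ e with p e = v, (e₀ :: r).count e =
        ∑ e with p e = v, r.count e + if v = p e₀ then 1 else 0 := by
      intro p
      simp only [List.count_cons, Finset.sum_add_distrib, beq_iff_eq]
      congr 1
      rw [Finset.sum_ite_eq]
      simp [eq_comm]
    rw [hsum, hsum]
    omega

lemma IsRoute.append {V E : Type*} {tail head : E → V} {k : V} : ∀ {r r' : List E} {i j : V},
    IsRoute tail head i j r → IsRoute tail head j k r' → IsRoute tail head i k (r ++ r')
  | [], _, _, _, h, h' => by
    obtain rfl := h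
    exact h'
  | _ :: _, _, _, _, h, h' => ⟨h.1, h.2.append h'⟩

/-- In an acyclic network with finitely many edges the relation "the head of `e'` is the tail of
`e`" is well-founded. -/
lemma TrafficNetwork.wellFounded_precedes {V E : Type*} [Finite E] (N : TrafficNetwork V E) :
    WellFounded fun e' e : E => N.head e' = N.tail e := by
  -- It is contained in the strict order of being joined by a nonempty route.
  let lt : E → E → Prop := fun e' e => ∃ r, IsRoute N.tail N.head (N.tail e') (N.tail e) (e' :: r)
  have : IsTrans E lt := ⟨fun a b c ⟨r, hr⟩ ⟨r', hr'⟩ => ⟨r ++ b :: r', hr.append hr'⟩⟩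
  have : Std.Irrefl lt := ⟨fun a ⟨r, hr⟩ => List.cons_ne_nil _ _ (N.acyclic _ _ hr)⟩
  exact Subrelation.wf (r := lt) (fun {e' e} h => ⟨[], rfl, h⟩)
    (Finite.wellFounded_of_trans_of_irrefl lt)

namespace Population

variable {V E G : Type*} [Fintype E] [Fintype G] {T : ℕ} {N : TrafficNetwork V E}

/-! ### The set of feasible flows -/

open Classical in
/-- Each group can send its whole demand along one route on the toll-free lanes. -/
lemma cbcpFeasible_nonempty (P : Population N G T) (τ : E → Fin T → ℝ) (B : P.eligible → ℝ)
    (hB : ∀ g, 0 ≤ B g) : (P.cbcpFeasible τ B).Nonempty := by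
  choose r hr using fun g => N.routes_nonempty _ (P.od_mem g)
  refine ⟨fun e k _ g => if k = 1 then P.demand g * (r g).count e else 0,
    ⟨fun e k t g => ?_, fun e k t g hg => ?_, fun i g t => ?_⟩, fun g => ?_⟩
  · dsimp only
    split_ifs
    · exact mul_nonneg (P.demand_nonneg g) (Nat.cast_nonneg _)
    · exact le_rfl
  · have hcount : (r g).count e = 0 := by
      refine List.count_eq_zero.2 fun he => hg ?_
      exact Finset.mem_filter.2 ⟨Finset.mem_univ _, r g, hr g, he⟩
    simp [hcount]
  · have h := congrArg (fun n : ℕ => P.demand g * (n : ℝ))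
      ((N.routes_isRoute _ (P.od_mem g) _ (hr g)).count_balance i)
    simp only [Nat.cast_add, Nat.cast_sum, Nat.cast_ite, Nat.cast_one, Nat.cast_zero, mul_add,
      mul_ite, mul_one, mul_zero, Finset.mul_sum] at h
    simpa using h
  · simpa using hB g

/-- Along an acyclic network the flow of an edge is bounded by the demand and the flows of the
edges that precede it. -/
lemma exists_flow_le (P : Population N G T) (e : E) :
    ∃ M : ℝ, ∀ y ∈ P.admissible, ∀ k t g, y e k t g ≤ M := by
  classical
  induction e using N.wellFounded_precedes.induction with
  | _ e ih =>
    choose M hM using ih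
    let M' : E → ℝ := fun e' => if h : N.head e' = N.tail e then 2 * M e' h else 0
    refine ⟨∑ g, P.demand g + ∑ e' with N.head e' = N.tail e, M' e', fun y hy k t g => ?_⟩
    have hbal := hy.2.2 (N.tail e) g t
    have hin : ∑ e' with N.head e' = N.tail e, ∑ k : Fin 2, y e' k t g ≤
        ∑ e' with N.head e' = N.tail e, M' e' := by
      refine Finset.sum_le_sum fun e' he' => ?_
      have he' := (Finset.mem_filter.1 he').2
      have h0 := hM e' he' y hy 0 t g
      have h1 := hM e' he' y hy 1 t g
      simp only [M', dif_pos he', Fin.sum_univ_two]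
      linarith
    have hlane : y e k t g ≤ ∑ k : Fin 2, y e k t g :=
      Finset.single_le_sum (f := fun k => y e k t g) (fun k _ => hy.1 e k t g) (Finset.mem_univ k)
    have hout : ∑ k : Fin 2, y e k t g ≤
        ∑ e' with N.tail e' = N.tail e, ∑ k : Fin 2, y e' k t g :=
      Finset.single_le_sum (f := fun e' => ∑ k : Fin 2, y e' k t g)
        (fun e' _ => Finset.sum_nonneg fun k _ => hy.1 e' k t g)
        (Finset.mem_filter.2 ⟨Finset.mem_univ e, rfl⟩)
    have hd : P.demand g ≤ ∑ g, P.demand g :=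
      Finset.single_le_sum (fun g _ => P.demand_nonneg g) (Finset.mem_univ g)
    have hd0 := P.demand_nonneg g
    have h1 : (if N.tail e = (P.od g).1 then P.demand g else 0) ≤ P.demand g := by
      split_ifs <;> linarith
    have h2 : 0 ≤ if N.tail e = (P.od g).2 then P.demand g else 0 := by
      split_ifs <;> linarith
    linarith

lemma isCompact_cbcpFeasible (P : Population N G T) (τ : E → Fin T → ℝ) (B : P.eligible → ℝ) :
    IsCompact (P.cbcpFeasible τ B) := by
  classical
  choose M hM using P.exists_flow_le
  have hbox : IsCompact (Set.pi Set.univ fun e => Set.pi Set.univ fun _ => Set.pi Set.univ fun _ =>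
      Set.pi Set.univ fun _ => Set.Icc 0 (M e) : Set (Flow E G T)) :=
    isCompact_univ_pi fun e => isCompact_univ_pi fun _ => isCompact_univ_pi fun _ =>
      isCompact_univ_pi fun _ => isCompact_Icc
  refine hbox.of_isClosed_subset ?_ fun y hy e _ k _ t _ g _ =>
    ⟨hy.1.1 e k t g, hM e y hy.1 k t g⟩
  have heq : P.cbcpFeasible τ B = {y | ((∀ e k t g, 0 ≤ y e k t g) ∧
      (∀ e k t g, g ∉ P.groupsOn e → y e k t g = 0) ∧ ∀ (i : V) (g : G) (t : Fin T),
      (if i = (P.od g).1 then P.demand g else 0)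
          + ∑ e ∈ Finset.univ.filter (fun e => N.head e = i), ∑ k : Fin 2, y e k t g
        = (if i = (P.od g).2 then P.demand g else 0)
          + ∑ e ∈ Finset.univ.filter (fun e => N.tail e = i), ∑ k : Fin 2, y e k t g) ∧
      ∀ g : P.eligible, ∑ t, ∑ e, y e 0 t g * τ e t ≤ B g} := by
    ext y
    simp only [cbcpFeasible, admissible, Set.mem_ofPred_eq]
  rw [heq]
  simp only [Set.ofPred_and, Set.ofPred_forall]
  refine ((isClosed_iInter fun e => isClosed_iInter fun k => isClosed_iInter fun t =>
    isClosed_iInter fun g => isClosed_le (by fun_prop) (by fun_prop)).inter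
    ((isClosed_iInter fun e => isClosed_iInter fun k => isClosed_iInter fun t =>
    isClosed_iInter fun g => isClosed_iInter fun _ => isClosed_eq (by fun_prop) (by fun_prop)).inter
    (isClosed_iInter fun i => isClosed_iInter fun g => isClosed_iInter fun t =>
      isClosed_eq (by fun_prop) (by fun_prop)))).inter
    (isClosed_iInter fun g => isClosed_le (by fun_prop) (by fun_prop))

lemma convex_cbcpFeasible (P : Population N G T) (τ : E → Fin T → ℝ) (B : P.eligible → ℝ) :
    Convex ℝ (P.cbcpFeasible τ B) := by
  classical
  rintro y ⟨⟨hy0, hyG, hyV⟩, hyB⟩ z ⟨⟨hz0, hzG, hzV⟩, hzB⟩ a b ha hb hab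
  refine ⟨⟨fun e k t g => ?_, fun e k t g hg => ?_, fun i g t => ?_⟩, fun g => ?_⟩
  · exact add_nonneg (mul_nonneg ha (hy0 e k t g)) (mul_nonneg hb (hz0 e k t g))
  · simp [hyG e k t g hg, hzG e k t g hg]
  · have h1 := hyV i g t
    have h2 := hzV i g t
    simp only [Pi.add_apply, Pi.smul_apply, smul_eq_mul, Finset.sum_add_distrib,
      ← Finset.mul_sum] at h1 h2 ⊢
    obtain rfl : b = 1 - a := by linarith
    linear_combination a * h1 + (1 - a) * h2
  · have h1 := mul_le_mul_of_nonneg_left (hyB g) ha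
    have h2 := mul_le_mul_of_nonneg_left (hzB g) hb
    simp only [Pi.add_apply, Pi.smul_apply, smul_eq_mul, add_mul, Finset.sum_add_distrib,
      mul_assoc, ← Finset.mul_sum]
    obtain rfl : b = 1 - a := by linarith
    linarith

/-- The constraints do not couple different groups: one group may switch to its part of any other
feasible flow. -/
lemma update_group_mem_cbcpFeasible [DecidableEq G] {P : Population N G T} {τ : E → Fin T → ℝ}
    {B : P.eligible → ℝ} {y z : Flow E G T} (hy : y ∈ P.cbcpFeasible τ B)
    (hz : z ∈ P.cbcpFeasible τ B) (g : G) :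
    (fun e k t => Function.update (y e k t) g (z e k t g)) ∈ P.cbcpFeasible τ B := by
  refine ⟨⟨fun e k t h => ?_, fun e k t h hh => ?_, fun i h t => ?_⟩, fun h => ?_⟩
  · by_cases hg : h = g
    · subst hg; simpa using hz.1.1 e k t h
    · simpa [hg] using hy.1.1 e k t h
  · by_cases hg : h = g
    · subst hg; simpa using hz.1.2.1 e k t h hh
    · simpa [hg] using hy.1.2.1 e k t h hh
  · by_cases hg : h = g
    · subst hg; simpa using hz.1.2.2 i h t
    · simpa [hg] using hy.1.2.2 i h t
  · by_cases hg : (h : G) = g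
    · subst hg; simpa using hz.2 h
    · simpa [hg] using hy.2 h

/-! ### Costs and equilibria -/

lemma continuousOn_cbcpCost (P : Population N G T) (τ : E → Fin T → ℝ) (B : P.eligible → ℝ)
    (e : E) (k : Fin 2) (t : Fin T) (g : G) :
    ContinuousOn (fun y => P.cbcpCost τ y e k t g) (P.cbcpFeasible τ B) := by
  have hlat : ContinuousOn (fun y => N.latency e (P.laneFlow y e k t)) (P.cbcpFeasible τ B) := by
    refine ((N.latency_convex e).continuousOn_Ici_of_monotoneOn (N.latency_monotone e)).comp
      (Continuous.continuousOn ?_) fun y hy => Finset.sum_nonneg fun g _ => hy.1.1 e k t g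
    unfold laneFlow
    fun_prop
  unfold cbcpCost
  split_ifs
  · exact (continuousOn_const.mul hlat).add continuousOn_const
  · exact continuousOn_const.mul hlat

/-- The total cost of a flow `z` at the prices that result from the flow `y`. -/
noncomputable def totalCost (P : Population N G T) (τ : E → Fin T → ℝ) (y : Flow E G T) :
    Flow E G T →ₗ[ℝ] ℝ where
  toFun z := ∑ g, ∑ e, ∑ k : Fin 2, ∑ t, z e k t g * P.cbcpCost τ y e k t g
  map_add' z w := by simp [add_mul, Finset.sum_add_distrib]
  map_smul' a z := by simp [mul_assoc, Finset.mul_sum, mul_add]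

end Population

end CBCP

theorem mainTheorem4 {V E G : Type*} [Fintype E] [Fintype G] {T : ℕ}
    (N : CBCP.TrafficNetwork V E) (P : CBCP.Population N G T)
    (τ : E → Fin T → ℝ) (hτ : ∀ e t, 0 ≤ τ e t)
    (B : P.eligible → ℝ) (hB : ∀ g, 0 ≤ B g) :
    (P.cbcpEquilibria τ B).Nonempty := by
  classical
  obtain ⟨y, hy, hvi⟩ := exists_variational_inequality (P.isCompact_cbcpFeasible τ B)
    (P.convex_cbcpFeasible τ B) (P.cbcpFeasible_nonempty τ B hB) (P.totalCost τ) (by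
      intro z _
      simp only [CBCP.Population.totalCost, LinearMap.coe_mk, AddHom.coe_mk]
      refine continuousOn_finsetSum _ fun g _ => continuousOn_finsetSum _ fun e _ =>
        continuousOn_finsetSum _ fun k _ => continuousOn_finsetSum _ fun t _ => ?_
      exact (Continuous.continuousOn (by fun_prop)).mul (P.continuousOn_cbcpCost τ B e k t g))
  refine ⟨y, hy, fun g z hz => ?_⟩
  have h := hvi _ (CBCP.Population.update_group_mem_cbcpFeasible hy hz g)
  simp only [CBCP.Population.totalCost, LinearMap.coe_mk, AddHom.coe_mk] at h
  rw [Finset.sum_eq_single g] at h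
  · simpa using h
  · intro h _ hne
    simp [hne]
  · simp
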